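/- Let $w_1,w_2,\dots$ be i.i.d. random variables, uniformly distributed on $(0,1]$, and for $\tau>0$ and $L\in\mathbb N$ put $v_{\tau,L}:=\prod_{k=1}^{L}(\tau w_k)$. 1. There are numbers $\tilde L$ ($L\ge 1$), depending on $L$ only, with $L-\tfrac13\le\tilde L\le L-1+\ln 2$, such that for all $\tau>0$ and $L\ge1$ the random variable $v_{\tau,L}$ has exactly one median, namely $\operatorname{median}[v_{\tau,L}]=e^{L\ln\tau-\tilde L}$. (A median of $X$ is a number $m$ with $P(X\le m)\ge\frac12$ and $P(X\ge m)\ge\frac12$.) 2. For $\tau=2$: $\operatorname{median}[v_{2,L}]\to0$ as $L\to\infty$, while $\mathbb E[v_{2,L}]=1$ for all $L$, $\mathbb E[v_{2,L}^2]<\infty$ for all $L$, and $\mathbb E[v_{2,L}^2]\to\infty$ as $L\to\infty$. 3. For $\tau=\sqrt3$: $\operatorname{median}[v_{\sqrt3,L}]\to0$ as $L\to\infty$, while $\mathbb E[v_{\sqrt3,L}^2]=1$ for all $L$. 4. For $\tau=e$ the median is stabilized: $e/2\le\operatorname{median}[v_{e,L}]\le e^{1/3}$ for all $L\ge1$. 5.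 For every $\tau>0$, almost surely $\lim_{L\to\infty}(v_{\tau,L})^{1/L}=\tau/e$, and hence, to first order in the exponent, $v_{\tau,L}=\exp\bigl(-L(1-\ln\tau)+o(L)\bigr)$ as $L\to\infty$. -/

import Mathlib

open MeasureTheory ProbabilityTheory Filter Topology Asymptotics

/-- The magnitude `v_{τ,L} = ∏ (τ w_k)` of the input-output map of a chain of depth `L`, where the
product runs over the first `L` weights (numbered from `0`). -/
noncomputable def chainMagnitude {Ω : Type*} (w : ℕ → Ω → ℝ) (τ : ℝ) (L : ℕ) (ω : Ω) : ℝ :=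
  ∏ k ∈ Finset.range L, (τ * w k ω)

/-- `m` is a median of the real random variable `X` under `P`:
`P(X ≤ m) ≥ 1/2` and `P(X ≥ m) ≥ 1/2`. -/
def IsMedian {Ω : Type*} [MeasurableSpace Ω] (P : Measure Ω) (X : Ω → ℝ) (m : ℝ) : Prop :=
  1 / 2 ≤ P.real {ω | X ω ≤ m} ∧ 1 / 2 ≤ P.real {ω | m ≤ X ω}

/-! The variable `-log w` is standard exponential, so `-log (w_0 ⋯ w_n)` has an Erlang law with tail
`erlangTail n`. This tail is continuous and strictly decreasing on `[0, ∞)`, so the product of `n +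
1` weights has the single median `exp (-x)`, where `erlangTail n x = 1/2`; the factor `τ ^ L` only
rescales it. Part 1 thus amounts to `n + 2/3 ≤ x ≤ n + log 2`, with `L = n + 1`.

These bounds follow by monotone convergence to `1/2`. By the central limit theorem `erlangTail n (n
+ c)` tends to `1/2` for every `c ≥ 0` (`tendsto_erlangTail`). For `c = 2/3` the sequence decreases
from `n = 1` on, hence stays above its limit; for `c = log 2` it increases from `n = 10` on, hence
stays below. The finitely many remaining cases are numerical.

The rest is softer: `E[w ^ p] = 1 / (p + 1)` and independence give the moments, and the strong law
with `E[log w] = -1` gives the almost sure rate. -/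

/-! ### Calculus of the Erlang tail. -/

/-- The tail `P(S ≥ x)`, `x ≥ 0`, of the Erlang distribution with shape `n + 1` and rate `1`. -/
noncomputable def erlangTail (n : ℕ) (x : ℝ) : ℝ :=
  Real.exp (-x) * ∑ k ∈ Finset.range (n + 1), x ^ k / (k.factorial : ℝ)

lemma erlangTail_zero (x : ℝ) : erlangTail 0 x = Real.exp (-x) := by
  simp [erlangTail]

lemma erlangTail_succ (n : ℕ) (x : ℝ) :
    erlangTail (n + 1) x =
      erlangTail n x + Real.exp (-x) * (x ^ (n + 1) / ((n + 1).factorial : ℝ)) := by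
  rw [erlangTail, Finset.sum_range_succ, mul_add, ← erlangTail]

lemma hasDerivAt_erlangTail (n : ℕ) (x : ℝ) :
    HasDerivAt (erlangTail n) (-(Real.exp (-x) * (x ^ n / (n.factorial : ℝ)))) x := by
  have hexp : HasDerivAt (fun x : ℝ => Real.exp (-x)) (-Real.exp (-x)) x := by
    simpa using (hasDerivAt_neg x).exp
  induction n with
  | zero =>
    have : erlangTail 0 = fun x => Real.exp (-x) := funext erlangTail_zero
    rw [this]
    simpa using hexp
  | succ n ih =>
    have : erlangTail (n + 1) = fun x =>
        erlangTail n x + Real.exp (-x) * (x ^ (n + 1) / ((n + 1).factorial : ℝ)) :=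
      funext (erlangTail_succ n)
    rw [this]
    refine (ih.add (hexp.mul ((hasDerivAt_pow (n + 1) x).div_const _))).congr_deriv ?_
    have h : (n.factorial : ℝ) ≠ 0 := by positivity
    rw [Nat.factorial_succ]
    push_cast
    field_simp
    simp

lemma continuous_erlangTail (n : ℕ) : Continuous (erlangTail n) :=
  continuous_iff_continuousAt.2 fun x => (hasDerivAt_erlangTail n x).continuousAt

lemma strictAntiOn_erlangTail (n : ℕ) : StrictAntiOn (erlangTail n) (Set.Ici 0) := by
  refine strictAntiOn_of_deriv_neg (convex_Ici 0) (continuous_erlangTail n).continuousOn ?_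
  intro x hx
  rw [interior_Ici] at hx
  have hx : 0 < x := hx
  rw [(hasDerivAt_erlangTail n x).deriv]
  exact neg_neg_of_pos (by positivity)

lemma erlangTail_at_zero (n : ℕ) : erlangTail n 0 = 1 := by
  simp [erlangTail, Finset.sum_range_succ']

/-! ### Polynomial bounds and the comparison of consecutive tails. -/

lemma sub_le_sub_of_deriv_le {f g f' g' : ℝ → ℝ} (hf : ∀ t, HasDerivAt f (f' t) t)
    (hg : ∀ t, HasDerivAt g (g' t) t) (h : ∀ t ∈ Set.Icc (0 : ℝ) 1, f' t ≤ g' t) :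
    f 1 - f 0 ≤ g 1 - g 0 := by
  have hd : ∀ t, HasDerivAt (fun t => g t - f t) (g' t - f' t) t := fun t => (hg t).sub (hf t)
  have hmono : MonotoneOn (fun t => g t - f t) (Set.Icc (0 : ℝ) 1) := by
    refine monotoneOn_of_deriv_nonneg (convex_Icc 0 1)
      (fun t _ => (hd t).continuousAt.continuousWithinAt)
      (fun t _ => (hd t).differentiableAt.differentiableWithinAt) fun t ht => ?_
    rw [(hd t).deriv]
    exact sub_nonneg.2 (h t (interior_subset ht))
  have := hmono (Set.left_mem_Icc.2 zero_le_one) (Set.right_mem_Icc.2 zero_le_one) zero_le_one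
  simp only at this
  linarith

/-- The difference of the two sides vanishes at `0` and has derivative `x ^ 3 / (1 + x)`; in
`le_log_one_add` it is `x ^ 4 / (1 + x)`. -/
lemma log_one_add_le {u : ℝ} (hu : 0 ≤ u) : Real.log (1 + u) ≤ u - u ^ 2 / 2 + u ^ 3 / 3 := by
  have hd : ∀ x : ℝ, 0 ≤ x → HasDerivAt (fun x => x - x ^ 2 / 2 + x ^ 3 / 3 - Real.log (1 + x))
      (1 - x + x ^ 2 - 1 / (1 + x)) x := by
    intro x hx
    have h1 := ((hasDerivAt_id x).const_add 1).log (by simp only [id]; positivity)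
    refine ((((hasDerivAt_id x).sub ((hasDerivAt_pow 2 x).div_const 2)).add
      ((hasDerivAt_pow 3 x).div_const 3)).sub h1).congr_deriv ?_
    simp
  have hmono : MonotoneOn (fun x => x - x ^ 2 / 2 + x ^ 3 / 3 - Real.log (1 + x))
      (Set.Ici (0 : ℝ)) := by
    refine monotoneOn_of_deriv_nonneg (convex_Ici 0)
      (fun t ht => (hd t ht).continuousAt.continuousWithinAt)
      (fun t ht => (hd t (interior_subset ht)).differentiableAt.differentiableWithinAt)
      fun t ht => ?_
    have ht : 0 ≤ t := interior_subset ht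
    rw [(hd t ht).deriv, sub_nonneg, div_le_iff₀ (by positivity)]
    nlinarith [pow_nonneg ht 3]
  have := hmono (Set.mem_Ici.2 le_rfl) hu hu
  simp at this
  linarith

lemma le_log_one_add {u : ℝ} (hu : 0 ≤ u) :
    u - u ^ 2 / 2 + u ^ 3 / 3 - u ^ 4 / 4 ≤ Real.log (1 + u) := by
  have hd : ∀ x : ℝ, 0 ≤ x →
      HasDerivAt (fun x => Real.log (1 + x) - (x - x ^ 2 / 2 + x ^ 3 / 3 - x ^ 4 / 4))
      (1 / (1 + x) - (1 - x + x ^ 2 - x ^ 3)) x := by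
    intro x hx
    have h1 := ((hasDerivAt_id x).const_add 1).log (by simp only [id]; positivity)
    refine (h1.sub ((((hasDerivAt_id x).sub ((hasDerivAt_pow 2 x).div_const 2)).add
      ((hasDerivAt_pow 3 x).div_const 3)).sub ((hasDerivAt_pow 4 x).div_const 4))).congr_deriv ?_
    simp
  have hmono : MonotoneOn (fun x => Real.log (1 + x) - (x - x ^ 2 / 2 + x ^ 3 / 3 - x ^ 4 / 4))
      (Set.Ici (0 : ℝ)) := by
    refine monotoneOn_of_deriv_nonneg (convex_Ici 0)
      (fun t ht => (hd t ht).continuousAt.continuousWithinAt)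
      (fun t ht => (hd t (interior_subset ht)).differentiableAt.differentiableWithinAt)
      fun t ht => ?_
    have ht : 0 ≤ t := interior_subset ht
    rw [(hd t ht).deriv, sub_nonneg, le_div_iff₀ (by positivity)]
    nlinarith [pow_nonneg ht 4]
  have := hmono (Set.mem_Ici.2 le_rfl) hu hu
  simp at this
  linarith

lemma exp_neg_mul_pow_add (n : ℕ) {y t : ℝ} (hy : 0 < y) (ht : 0 ≤ t) :
    Real.exp (-(y + t)) * (y + t) ^ n =
      Real.exp (-y) * y ^ n * Real.exp (-t + n * Real.log (1 + t / y)) := by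
  have h1 : 0 < 1 + t / y := by positivity
  have h2 : y + t = y * (1 + t / y) := by field_simp
  rw [Real.exp_add (-t), mul_comm (n : ℝ), Real.exp_mul, Real.exp_log h1, Real.rpow_natCast,
    neg_add, Real.exp_add, h2, mul_pow]
  ring

lemma hasDerivAt_neg_erlangTail_add (n : ℕ) (y t : ℝ) :
    HasDerivAt (fun t => -erlangTail n (y + t))
      (Real.exp (-(y + t)) * ((y + t) ^ n / (n.factorial : ℝ))) t := by
  exact ((hasDerivAt_erlangTail n (y + t)).comp_const_add y t).neg.congr_deriv (neg_neg _)

lemma hasDerivAt_quartic_prim (a b c d e t : ℝ) :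
    HasDerivAt (fun t : ℝ => a * t + b * t ^ 2 / 2 + c * t ^ 3 / 3 + d * t ^ 4 / 4 + e * t ^ 5 / 5)
      (a + b * t + c * t ^ 2 + d * t ^ 3 + e * t ^ 4) t := by
  have h (k : ℕ) (s : ℝ) := ((hasDerivAt_pow k t).const_mul s).div_const (k : ℝ)
  refine ((((((hasDerivAt_id t).const_mul a).add (h 2 b)).add (h 3 c)).add (h 4 d)).add
    (h 5 e)).congr_deriv ?_
  norm_num
  ring

/-- Passing from `n` to `n + 1` at `y` adds `g`; moving from `y` to `y + 1` then removes the
integral over `[0, 1]` of the Erlang density, which is `g` times `exp (-t + (n + 1) log (1 + t /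
y))`. So the sign of the change is decided by whether that exponential integrates to more or less
than `1`, and a quartic minorant suffices. `le_erlangTail_succ_of_le` is the mirror image with a
majorant. -/
lemma erlangTail_succ_le_of_le (n : ℕ) {y : ℝ} (hy : 0 < y) (a b c d e : ℝ)
    (hint : 1 ≤ a + b / 2 + c / 3 + d / 4 + e / 5)
    (h : ∀ t ∈ Set.Icc (0 : ℝ) 1, a + b * t + c * t ^ 2 + d * t ^ 3 + e * t ^ 4 ≤
      Real.exp (-t + ((n + 1 : ℕ) : ℝ) * Real.log (1 + t / y))) :
    erlangTail (n + 1) (y + 1) ≤ erlangTail n y := by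
  set g : ℝ := Real.exp (-y) * y ^ (n + 1) / ((n + 1).factorial : ℝ) with hg
  have hg0 : 0 < g := by positivity
  have key := sub_le_sub_of_deriv_le (fun t => (hasDerivAt_quartic_prim a b c d e t).const_mul g)
    (hasDerivAt_neg_erlangTail_add (n + 1) y) (by
      intro t ht
      rw [← mul_div_assoc, exp_neg_mul_pow_add _ hy ht.1, mul_div_right_comm, ← hg]
      exact mul_le_mul_of_nonneg_left (h t ht) hg0.le)
  have hs := erlangTail_succ n y
  rw [← mul_div_assoc, ← hg] at hs
  simp only [add_zero] at key
  norm_num at key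
  nlinarith

lemma le_erlangTail_succ_of_le (n : ℕ) {y : ℝ} (hy : 0 < y) (a b c d e : ℝ)
    (hint : a + b / 2 + c / 3 + d / 4 + e / 5 ≤ 1)
    (h : ∀ t ∈ Set.Icc (0 : ℝ) 1, Real.exp (-t + ((n + 1 : ℕ) : ℝ) * Real.log (1 + t / y)) ≤
      a + b * t + c * t ^ 2 + d * t ^ 3 + e * t ^ 4) :
    erlangTail n y ≤ erlangTail (n + 1) (y + 1) := by
  set g : ℝ := Real.exp (-y) * y ^ (n + 1) / ((n + 1).factorial : ℝ) with hg
  have hg0 : 0 < g := by positivity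
  have key := sub_le_sub_of_deriv_le (hasDerivAt_neg_erlangTail_add (n + 1) y)
    (fun t => (hasDerivAt_quartic_prim a b c d e t).const_mul g) (by
      intro t ht
      rw [← mul_div_assoc, exp_neg_mul_pow_add _ hy ht.1, mul_div_right_comm, ← hg]
      exact mul_le_mul_of_nonneg_left (h t ht) hg0.le)
  have hs := erlangTail_succ n y
  rw [← mul_div_assoc, ← hg] at hs
  simp only [add_zero] at key
  norm_num at key
  nlinarith

lemma erlangTail_add_two_thirds_succ_le {n : ℕ} (hn : 1 ≤ n) :
    erlangTail (n + 1) (((n + 1 : ℕ) : ℝ) + 2 / 3) ≤ erlangTail n (n + 2 / 3) := by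
  obtain ⟨y, hy⟩ : ∃ y : ℝ, y = n + 2 / 3 := ⟨_, rfl⟩
  have hn' : (1 : ℝ) ≤ n := by exact_mod_cast hn
  have hy0 : 5 / 3 ≤ y := by linarith
  have hpos : 0 < y := by linarith
  have hcast : ((n + 1 : ℕ) : ℝ) = y + 1 / 3 := by push_cast; linarith
  have e1 : ((n + 1 : ℕ) : ℝ) + 2 / 3 = y + 1 := by rw [hcast]; ring
  rw [e1, ← hy]
  obtain ⟨r, hr⟩ : ∃ r : ℝ, r = y⁻¹ := ⟨_, rfl⟩
  have hr0 : 0 < r := hr ▸ inv_pos.2 hpos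
  have hyr : y * r = 1 := by rw [hr]; field_simp
  have hr1 : r ≤ 3 / 5 := by nlinarith
  -- With `r = 1 / y` and `n + 1 = y + 1/3`, the quartic is `1 + z`, where `z` is the exponent with
  -- the logarithm replaced by its degree 4 Taylor polynomial; then `exp z ≥ 1 + z`.
  refine erlangTail_succ_le_of_le n hpos 1 (r / 3) (-r / 2 - r ^ 2 / 6) (r ^ 2 / 3 + r ^ 3 / 9)
    (-r ^ 3 / 4 - r ^ 4 / 12) ?_ fun t ht => ?_
  -- The integral exceeds `1` by `r ^ 2` times this expression: the shift `2/3` is the one for which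
  -- the term linear in `r` cancels.
  · have h1 : 0 ≤ 1 / 36 - r / 45 - r ^ 2 / 60 := by nlinarith
    nlinarith [mul_nonneg (sq_nonneg r) h1]
  · have hlog := le_log_one_add (u := t / y) (div_nonneg ht.1 hpos.le)
    rw [hcast]
    have hm := mul_le_mul_of_nonneg_left hlog (show 0 ≤ y + 1 / 3 by positivity)
    refine le_trans ?_ (Real.add_one_le_exp _)
    have : t / y = t * r := by rw [hr]; rfl
    rw [this] at hm ⊢
    have e2 : (y + 1 / 3) * (t * r - (t * r) ^ 2 / 2 + (t * r) ^ 3 / 3 - (t * r) ^ 4 / 4) =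
      t + (r / 3) * t + (-r / 2 - r ^ 2 / 6) * t ^ 2 + (r ^ 2 / 3 + r ^ 3 / 9) * t ^ 3 +
      (-r ^ 3 / 4 - r ^ 4 / 12) * t ^ 4 := by
      linear_combination (t - t ^ 2 * r / 2 + t ^ 3 * r ^ 2 / 3 - t ^ 4 * r ^ 3 / 4) * hyr
    linarith

lemma abs_cubic_le {r t : ℝ} (hr0 : 0 < r) (hr1 : r ≤ 1 / 10) (ht0 : 0 ≤ t) (ht1 : t ≤ 1) :
    |0.307 * r * t + (-r / 2 - 0.153 * r ^ 2) * t ^ 2 + 0.345 * r ^ 2 * t ^ 3| ≤ 0.31 * r := by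
  have ht2 : t ^ 2 ≤ 1 := pow_le_one₀ ht0 ht1
  have ht3 : t ^ 3 ≤ 1 := pow_le_one₀ ht0 ht1
  have q1 : 0.307 * t - t ^ 2 / 2 ≤ 0.05 := by nlinarith [sq_nonneg (t - 0.307)]
  have q2 : -0.2 ≤ 0.307 * t - t ^ 2 / 2 := by nlinarith
  have p1 : 0.345 * t ^ 3 - 0.153 * t ^ 2 ≤ 1 := by nlinarith [sq_nonneg t]
  have p2 : -1 ≤ 0.345 * t ^ 3 - 0.153 * t ^ 2 := by linarith [pow_nonneg ht0 3]
  have hrr : r ^ 2 ≤ 0.1 * r := by nlinarith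
  have hE' : 0.307 * r * t + (-r / 2 - 0.153 * r ^ 2) * t ^ 2 + 0.345 * r ^ 2 * t ^ 3 =
      r * (0.307 * t - t ^ 2 / 2) + r ^ 2 * (0.345 * t ^ 3 - 0.153 * t ^ 2) := by
    ring
  have m1 := mul_le_mul_of_nonneg_left q1 hr0.le
  have m2 := mul_le_mul_of_nonneg_left q2 hr0.le
  have m3 := mul_le_mul_of_nonneg_left p1 (sq_nonneg r)
  have m4 := mul_le_mul_of_nonneg_left p2 (sq_nonneg r)
  rw [abs_le, hE']
  constructor <;> linarith

lemma le_erlangTail_add_log_two_succ {n : ℕ} (hn : 10 ≤ n) :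
    erlangTail n (n + Real.log 2) ≤ erlangTail (n + 1) (((n + 1 : ℕ) : ℝ) + Real.log 2) := by
  obtain ⟨y, hy⟩ : ∃ y : ℝ, y = n + Real.log 2 := ⟨_, rfl⟩
  obtain ⟨δ, hδ⟩ : ∃ δ : ℝ, δ = 1 - Real.log 2 := ⟨_, rfl⟩
  have hδ1 : δ ≤ 0.307 := by linarith [Real.log_two_gt_d9]
  have hδ0 : 0.306 ≤ δ := by linarith [Real.log_two_lt_d9]
  have hn' : (10 : ℝ) ≤ n := by exact_mod_cast hn
  have hy0 : 10 ≤ y := by linarith [Real.log_two_gt_d9]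
  have hpos : 0 < y := by linarith
  have hcast : ((n + 1 : ℕ) : ℝ) = y + δ := by push_cast; linarith
  have e1 : ((n + 1 : ℕ) : ℝ) + Real.log 2 = y + 1 := by rw [hcast]; linarith
  rw [e1, ← hy]
  obtain ⟨r, hr⟩ : ∃ r : ℝ, r = y⁻¹ := ⟨_, rfl⟩
  have hr0 : 0 < r := hr ▸ inv_pos.2 hpos
  have hyr : y * r = 1 := by rw [hr]; field_simp
  have hr1 : r ≤ 1 / 10 := by nlinarith
  -- The majorant is `1 + E + 0.1 r ^ 2`: here `E` is a cubic bound for the exponent, with `δ`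
  -- rounded to `0.307` or `0.306` according to sign, and `0.1 r ^ 2` absorbs the error `E ^ 2` of
  -- `exp E ≈ 1 + E`.
  refine le_erlangTail_succ_of_le n hpos (1 + 0.1 * r ^ 2) (0.307 * r)
    (-r / 2 - 0.153 * r ^ 2) (0.345 * r ^ 2) 0 ?_ fun t ht => ?_
  -- This amounts to `0.13525 r ≤ 0.01316…`, that is, `r` below about `0.0973`. The bound `r ≤ 1/10`
  -- is not enough; `y = n + log 2 > 10.69` is needed.
  · nlinarith
  · obtain ⟨ht0, ht1⟩ := ht
    have hlog := log_one_add_le (u := t / y) (div_nonneg ht0 hpos.le)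
    rw [hcast]
    have hm := mul_le_mul_of_nonneg_left hlog (show 0 ≤ y + δ by positivity)
    have : t / y = t * r := by rw [hr]; rfl
    rw [this] at hm ⊢
    have e2 : (y + δ) * (t * r - (t * r) ^ 2 / 2 + (t * r) ^ 3 / 3) =
      t + δ * (r * t) + (-r / 2) * t ^ 2 - δ * (r ^ 2 * t ^ 2) / 2 + (r ^ 2 * t ^ 3) * (1 / 3)
      + (δ * r) * (r ^ 2 * t ^ 3) / 3 := by
      linear_combination (t - t ^ 2 * r / 2 + t ^ 3 * r ^ 2 / 3) * hyr
    obtain ⟨E, hE⟩ : ∃ E : ℝ, E = 0.307 * r * t + (-r / 2 - 0.153 * r ^ 2) * t ^ 2 +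
      0.345 * r ^ 2 * t ^ 3 := ⟨_, rfl⟩
    have hle : -t + (y + δ) * Real.log (1 + t * r) ≤ E := by
      have a1 : δ * (r * t) ≤ 0.307 * (r * t) := mul_le_mul_of_nonneg_right hδ1 (by positivity)
      have a2 : 0.306 * (r ^ 2 * t ^ 2) ≤ δ * (r ^ 2 * t ^ 2) :=
        mul_le_mul_of_nonneg_right hδ0 (by positivity)
      have a3 : (δ * r) * (r ^ 2 * t ^ 3) ≤ 0.0307 * (r ^ 2 * t ^ 3) :=
        mul_le_mul_of_nonneg_right (by nlinarith) (by positivity)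
      have a4 : 0 ≤ r ^ 2 * t ^ 3 := by positivity
      rw [hE]
      linarith
    have hE1 : |E| ≤ 0.31 * r := hE ▸ abs_cubic_le hr0 hr1 ht0 ht1
    have hexp := Real.abs_exp_sub_one_sub_id_le (x := E) (hE1.trans (by linarith))
    have hsq : E ^ 2 ≤ 0.1 * r ^ 2 := by
      rw [← sq_abs]
      have := pow_le_pow_left₀ (abs_nonneg E) hE1 2
      rw [mul_pow] at this
      linarith [sq_nonneg r]
    have := (abs_le.1 hexp).2
    have := Real.exp_le_exp.2 hle
    linarith

/-- Since `exp (-(n + log 2)) = e ^ (-n) / 2`, the claim is that the partial exponential sum is at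
most `e ^ n`, which rational bounds for `log 2` and `e` settle. At `n = 0` there is equality. -/
lemma erlangTail_add_log_two_le_of_lt {n : ℕ} (hn : n < 10) :
    erlangTail n (n + Real.log 2) ≤ 1 / 2 := by
  have h2 : Real.exp (-((n : ℝ) + Real.log 2)) = (Real.exp 1 ^ n)⁻¹ / 2 := by
    rw [neg_add, Real.exp_add, Real.exp_neg, Real.exp_neg, Real.exp_log two_pos, ← Real.exp_nat_mul]
    simp [div_eq_mul_inv]
  have hlog : Real.log 2 ≤ 0.6932 := by linarith [Real.log_two_lt_d9]
  have hlog0 : 0 ≤ Real.log 2 := Real.log_nonneg one_le_two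
  have key : ∑ k ∈ Finset.range (n + 1), ((n : ℝ) + Real.log 2) ^ k / (k.factorial : ℝ) ≤
      Real.exp 1 ^ n := by
    calc _ ≤ ∑ k ∈ Finset.range (n + 1), ((n : ℝ) + 0.6932) ^ k / (k.factorial : ℝ) := by
          gcongr
      _ ≤ (2.71828 : ℝ) ^ n := by
          interval_cases n <;> norm_num [Finset.sum_range_succ, Nat.factorial]
      _ ≤ _ := by
          gcongr
          linarith [Real.exp_one_gt_d9]
  rw [erlangTail, h2]
  have hpos : 0 < Real.exp 1 ^ n := by positivity
  calc _ ≤ (Real.exp 1 ^ n)⁻¹ / 2 * Real.exp 1 ^ n := by gcongr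
    _ = 1 / 2 := by field_simp

lemma half_le_erlangTail_zero : 1 / 2 ≤ erlangTail 0 (2 / 3) := by
  rw [erlangTail_zero, show (1 / 2 : ℝ) = Real.exp (-Real.log 2) by
    rw [Real.exp_neg, Real.exp_log two_pos]; norm_num]
  exact Real.exp_le_exp.2 (by linarith [Real.log_two_gt_d9])

/-- A decreasing sequence lies above its limit. The index `0` is separate because the step estimate
is available only from `n = 1`. -/
lemma half_le_erlangTail (hlim : Tendsto (fun n : ℕ => erlangTail n (n + 2 / 3)) atTop (𝓝 (1 / 2)))
    (n : ℕ) : 1 / 2 ≤ erlangTail n (n + 2 / 3) := by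
  rcases Nat.eq_zero_or_pos n with rfl | hn
  · simpa using half_le_erlangTail_zero
  · have hanti : Antitone fun k : ℕ => erlangTail (k + n) (((k + n : ℕ) : ℝ) + 2 / 3) :=
      antitone_nat_of_succ_le fun k => by
        have := erlangTail_add_two_thirds_succ_le (n := k + n) (by omega)
        rwa [show k + 1 + n = k + n + 1 by ring]
    simpa using hanti.le_of_tendsto ((tendsto_add_atTop_iff_nat n).2 hlim) 0

lemma erlangTail_le_half
    (hlim : Tendsto (fun n : ℕ => erlangTail n (n + Real.log 2)) atTop (𝓝 (1 / 2))) (n : ℕ) :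
    erlangTail n (n + Real.log 2) ≤ 1 / 2 := by
  rcases lt_or_ge n 10 with hn | hn
  · exact erlangTail_add_log_two_le_of_lt hn
  · have hmono : Monotone fun k : ℕ => erlangTail (k + n) (((k + n : ℕ) : ℝ) + Real.log 2) :=
      monotone_nat_of_le_succ fun k => by
        have := le_erlangTail_add_log_two_succ (n := k + n) (by omega)
        rwa [show k + 1 + n = k + n + 1 by ring]
    simpa using hmono.ge_of_tendsto ((tendsto_add_atTop_iff_nat n).2 hlim) 0

/-! ### Transfer from uniform variables to integrals over `(0, 1]`. -/

section Uniform

variable {Ω : Type*} [MeasurableSpace Ω] {P : Measure Ω}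

lemma map_eq_restrict_Ioc {u : Ω → ℝ} (hu : pdf.IsUniform u (Set.Ioc (0 : ℝ) 1) P volume) :
    P.map u = volume.restrict (Set.Ioc (0 : ℝ) 1) := by
  rw [pdf.IsUniform] at hu
  rw [hu, ProbabilityTheory.cond]
  simp

lemma ae_mem_Ioc {u : Ω → ℝ} (hm : Measurable u)
    (hu : pdf.IsUniform u (Set.Ioc (0 : ℝ) 1) P volume) : ∀ᵐ ω ∂P, u ω ∈ Set.Ioc (0 : ℝ) 1 := by
  have h : ∀ᵐ x ∂(P.map u), x ∈ Set.Ioc (0 : ℝ) 1 := by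
    rw [map_eq_restrict_Ioc hu]
    exact ae_restrict_mem measurableSet_Ioc
  exact ae_of_ae_map hm.aemeasurable h

lemma integral_comp_uniform {u : Ω → ℝ} (hm : Measurable u)
    (hu : pdf.IsUniform u (Set.Ioc (0 : ℝ) 1) P volume) {g : ℝ → ℝ} (hg : Measurable g) :
    ∫ ω, g (u ω) ∂P = ∫ x in (0 : ℝ)..1, g x := by
  rw [← integral_map hm.aemeasurable hg.aestronglyMeasurable, map_eq_restrict_Ioc hu,
    intervalIntegral.integral_of_le zero_le_one]

lemma integrable_comp_uniform {u : Ω → ℝ} (hm : Measurable u)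
    (hu : pdf.IsUniform u (Set.Ioc (0 : ℝ) 1) P volume) {g : ℝ → ℝ} (hg : Measurable g)
    (hint : IntervalIntegrable g volume 0 1) : Integrable (fun ω => g (u ω)) P := by
  rw [intervalIntegrable_iff_integrableOn_Ioc_of_le zero_le_one] at hint
  refine (integrable_map_measure hg.aestronglyMeasurable hm.aemeasurable).1 ?_
  rwa [map_eq_restrict_Ioc hu]

end Uniform

/-! ### Mean and variance of the logarithm of a uniform variable. -/

section LogMoments

lemma integral_log_zero_one : ∫ x in (0 : ℝ)..1, Real.log x = -1 := by
  simp [integral_log]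

lemma continuousOn_mul_log_sq : ContinuousOn (fun x : ℝ => x * Real.log x ^ 2) (Set.Ici 0) := by
  -- Writing `x log² x = 4 (√x log √x)²` reduces continuity at `0` to that of `x log x`.
  have h : Continuous fun x : ℝ => 4 * (√x * Real.log √x) ^ 2 :=
    ((Real.continuous_mul_log.comp Real.continuous_sqrt).pow 2).const_mul 4
  refine h.continuousOn.congr fun x hx => ?_
  simp only
  rw [Real.log_sqrt hx, mul_pow, Real.sq_sqrt hx]
  ring

lemma integral_log_add_one_sq : ∫ x in (0 : ℝ)..1, (Real.log x + 1) ^ 2 = 1 := by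
  have hcont : ContinuousOn (fun x : ℝ => x * Real.log x ^ 2 + x) (Set.Icc 0 1) :=
    (continuousOn_mul_log_sq.mono Set.Icc_subset_Ici_self).add continuousOn_id
  have hderiv : ∀ x ∈ Set.Ioo (0 : ℝ) 1,
      HasDerivAt (fun x : ℝ => x * Real.log x ^ 2 + x) ((Real.log x + 1) ^ 2) x := by
    intro x hx
    have hx0 : x ≠ 0 := hx.1.ne'
    refine (((hasDerivAt_id x).mul ((Real.hasDerivAt_log hx0).pow 2)).add
      (hasDerivAt_id x)).congr_deriv ?_
    simp only [id, Pi.pow_apply]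
    field_simp
    push_cast
    ring
  have hint : IntervalIntegrable (fun x : ℝ => (Real.log x + 1) ^ 2) volume 0 1 :=
    intervalIntegral.intervalIntegrable_deriv_of_nonneg (by rwa [Set.uIcc_of_le zero_le_one])
      (by simpa using hderiv) (fun x _ => sq_nonneg _)
  rw [intervalIntegral.integral_eq_sub_of_hasDerivAt_of_le zero_le_one hcont hderiv hint]
  simp

end LogMoments

/-! ### Law of the product of weights, and its central limit theorem. -/

section ErlangLaw

lemma hasDerivAt_mul_erlangTail_log (n : ℕ) (x : ℝ) {b : ℝ} (hb : 0 < b) :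
    HasDerivAt (fun b => b * erlangTail (n + 1) (x + Real.log b))
      (erlangTail n (x + Real.log b)) b := by
  have h1 : HasDerivAt (fun b => x + Real.log b) b⁻¹ b := (Real.hasDerivAt_log hb.ne').const_add x
  have h2 := (hasDerivAt_erlangTail (n + 1) (x + Real.log b)).comp b h1
  refine ((hasDerivAt_id b).mul h2).congr_deriv ?_
  simp only [id, Function.comp, erlangTail_succ]
  field_simp
  ring

lemma integral_erlangTail_log (n : ℕ) {x : ℝ} (hx : 0 ≤ x) :
    ∫ b in Real.exp (-x)..1, erlangTail n (x + Real.log b) =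
      erlangTail (n + 1) x - Real.exp (-x) := by
  have hle : Real.exp (-x) ≤ 1 := Real.exp_le_one_iff.2 (by linarith)
  have hpos : ∀ b ∈ Set.uIcc (Real.exp (-x)) 1, 0 < b := by
    intro b hb
    rw [Set.uIcc_of_le hle] at hb
    exact (Real.exp_pos _).trans_le hb.1
  rw [intervalIntegral.integral_eq_sub_of_hasDerivAt
    (fun b hb => hasDerivAt_mul_erlangTail_log n x (hpos b hb))]
  · simp [erlangTail_at_zero]
  · refine ContinuousOn.intervalIntegrable fun b hb => ContinuousAt.continuousWithinAt ?_
    exact (continuous_erlangTail n).continuousAt.comp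
      (continuousAt_const.add (Real.continuousAt_log (hpos b hb).ne'))

variable {Ω : Type*} [MeasurableSpace Ω] {P : Measure Ω} {w : ℕ → Ω → ℝ}

lemma measurable_prod_range (hmeas : ∀ k, Measurable (w k)) (n : ℕ) :
    Measurable fun ω => ∏ k ∈ Finset.range n, w k ω := by
  fun_prop

lemma indepFun_prod_range (hmeas : ∀ k, Measurable (w k)) (hindep : iIndepFun w P) (n : ℕ) :
    IndepFun (fun ω => ∏ k ∈ Finset.range n, w k ω) (w n) P := by
  have := hindep.indepFun_prod_range_succ hmeas n
  convert this using 1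
  ext ω
  simp

variable [IsProbabilityMeasure P]

lemma measureReal_mul_le_uniform {u v : Ω → ℝ} (hu : Measurable u) (hv : Measurable v)
    (hunif : pdf.IsUniform u (Set.Ioc (0 : ℝ) 1) P volume) (hind : IndepFun v u P) (z : ℝ) :
    P.real {ω | v ω * u ω ≤ z} = ∫ b in (0 : ℝ)..1, P.real {ω | v ω ≤ z / b} := by
  have hs : MeasurableSet {p : ℝ × ℝ | p.1 * p.2 ≤ z} :=
    measurableSet_le (by fun_prop) measurable_const
  have : IsProbabilityMeasure (P.map v) := Measure.isProbabilityMeasure_map hv.aemeasurable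
  have h1 : P.real {ω | v ω * u ω ≤ z} =
      ((P.map v).prod (P.map u) {p : ℝ × ℝ | p.1 * p.2 ≤ z}).toReal := by
    have : IsProbabilityMeasure (P.map u) := Measure.isProbabilityMeasure_map hu.aemeasurable
    rw [← hind.map_prod_eq_prod_map_map hv.aemeasurable hu.aemeasurable,
      Measure.map_apply (hv.prodMk hu) hs]
    rfl
  rw [h1, map_eq_restrict_Ioc hunif, Measure.prod_apply_symm hs, ← integral_toReal
    (measurable_measure_prodMk_right hs).aemeasurable (ae_of_all _ fun _ => measure_lt_top _ _),
    intervalIntegral.integral_of_le zero_le_one]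
  refine setIntegral_congr_fun measurableSet_Ioc fun b hb => ?_
  rw [Measure.map_apply hv (measurable_prodMk_right hs)]
  simp only [Measure.real]
  congr 2
  ext ω
  simp [le_div_iff₀ hb.1]

/-- Induction by conditioning on the last factor `b`. For `b ≤ exp (-x)` the conditional probability
is `1`; otherwise it is `erlangTail n (x + log b)`, whose antiderivative in `b` is `b * erlangTail
(n + 1) (x + log b)`. -/
lemma measureReal_prod_le (hmeas : ∀ k, Measurable (w k))
    (hunif : ∀ k, pdf.IsUniform (w k) (Set.Ioc (0 : ℝ) 1) P volume) (hindep : iIndepFun w P)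
    (n : ℕ) : ∀ x : ℝ, 0 ≤ x →
    P.real {ω | ∏ k ∈ Finset.range (n + 1), w k ω ≤ Real.exp (-x)} = erlangTail n x := by
  induction n with
  | zero =>
    intro x hx
    have hle : Real.exp (-x) ≤ 1 := Real.exp_le_one_iff.2 (by linarith)
    have h := map_measureReal_apply (μ := P) (hmeas 0) (measurableSet_Iic (a := Real.exp (-x)))
    rw [map_eq_restrict_Ioc (hunif 0), measureReal_restrict_apply measurableSet_Iic,
      Set.inter_comm, Set.Ioc_inter_Iic, min_eq_right hle] at h
    rw [erlangTail_zero]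
    simpa [Set.preimage, (Real.exp_pos _).le] using h.symm
  | succ n ih =>
    intro x hx
    have hle : Real.exp (-x) ≤ 1 := Real.exp_le_one_iff.2 (by linarith)
    simp_rw [Finset.prod_range_succ _ (n + 1)]
    rw [measureReal_mul_le_uniform (hmeas _) (measurable_prod_range hmeas _) (hunif _)
      (indepFun_prod_range hmeas hindep _)]
    have hone : ∀ c : ℝ, 1 ≤ c → P.real {ω | ∏ k ∈ Finset.range (n + 1), w k ω ≤ c} = 1 := by
      intro c hc
      refine le_antisymm measureReal_le_one ?_
      have := ih 0 le_rfl
      rw [erlangTail_at_zero, neg_zero, Real.exp_zero] at this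
      rw [← this]
      exact measureReal_mono (Set.ofPred_subset_ofPred.2 fun ω hω => hω.trans hc)
    have hcongr1 : ∀ b ∈ Set.Ioc 0 (Real.exp (-x)),
        P.real {ω | ∏ k ∈ Finset.range (n + 1), w k ω ≤ Real.exp (-x) / b} = 1 := fun b hb =>
      hone _ ((one_le_div hb.1).2 hb.2)
    have hcongr2 : ∀ b ∈ Set.Icc (Real.exp (-x)) 1,
        P.real {ω | ∏ k ∈ Finset.range (n + 1), w k ω ≤ Real.exp (-x) / b} =
          erlangTail n (x + Real.log b) := fun b hb => by
      have hb0 : 0 < b := (Real.exp_pos _).trans_le hb.1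
      rw [← ih (x + Real.log b), neg_add, Real.exp_add, Real.exp_neg (Real.log b),
        Real.exp_log hb0, div_eq_mul_inv]
      have := (Real.le_log_iff_exp_le hb0).2 hb.1
      linarith
    have hint1 : IntervalIntegrable (fun b => P.real
        {ω | ∏ k ∈ Finset.range (n + 1), w k ω ≤ Real.exp (-x) / b}) volume 0 (Real.exp (-x)) := by
      refine (intervalIntegrable_const (c := (1 : ℝ))).congr ?_
      rw [Set.uIoc_of_le (Real.exp_pos _).le]
      exact fun b hb => (hcongr1 b hb).symm
    have hint2 : IntervalIntegrable (fun b => P.real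
        {ω | ∏ k ∈ Finset.range (n + 1), w k ω ≤ Real.exp (-x) / b}) volume (Real.exp (-x)) 1 := by
      refine ContinuousOn.intervalIntegrable ?_
      rw [Set.uIcc_of_le hle]
      refine ContinuousOn.congr (fun b hb => ContinuousAt.continuousWithinAt ?_) hcongr2
      exact (continuous_erlangTail n).continuousAt.comp (continuousAt_const.add
        (Real.continuousAt_log ((Real.exp_pos _).trans_le hb.1).ne'))
    have heq1 : ∫ b in 0..Real.exp (-x), P.real
        {ω | ∏ k ∈ Finset.range (n + 1), w k ω ≤ Real.exp (-x) / b} = Real.exp (-x) := by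
      rw [intervalIntegral.integral_congr_ae (g := fun _ => (1 : ℝ))]
      · simp
      · rw [Set.uIoc_of_le (Real.exp_pos _).le]
        exact ae_of_all _ hcongr1
    have heq2 : ∫ b in Real.exp (-x)..1, P.real
        {ω | ∏ k ∈ Finset.range (n + 1), w k ω ≤ Real.exp (-x) / b} =
          erlangTail (n + 1) x - Real.exp (-x) := by
      rw [← integral_erlangTail_log n hx]
      refine intervalIntegral.integral_congr ?_
      rw [Set.uIcc_of_le hle]
      exact hcongr2
    rw [← intervalIntegral.integral_add_adjacent_intervals hint1 hint2, heq1, heq2]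
    ring

/-- The product has no atom at `exp (-x)`: the event contains `{∏ ≤ exp (-y)}` for every `y > x`,
and the tail is continuous. -/
lemma measureReal_prod_lt (hmeas : ∀ k, Measurable (w k))
    (hunif : ∀ k, pdf.IsUniform (w k) (Set.Ioc (0 : ℝ) 1) P volume) (hindep : iIndepFun w P)
    (n : ℕ) {x : ℝ} (hx : 0 ≤ x) :
    P.real {ω | ∏ k ∈ Finset.range (n + 1), w k ω < Real.exp (-x)} = erlangTail n x := by
  refine le_antisymm ?_ ?_
  · rw [← measureReal_prod_le hmeas hunif hindep n x hx]
    exact measureReal_mono (Set.ofPred_subset_ofPred.2 fun ω hω => hω.le)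
  · have h : Tendsto (erlangTail n) (𝓝[>] x) (𝓝 (erlangTail n x)) :=
      (continuous_erlangTail n).continuousAt.tendsto.mono_left nhdsWithin_le_nhds
    refine le_of_tendsto h ?_
    filter_upwards [self_mem_nhdsWithin] with y hy
    have hy : x < y := hy
    rw [← measureReal_prod_le hmeas hunif hindep n y (hx.trans hy.le)]
    exact measureReal_mono (Set.ofPred_subset_ofPred.2 fun ω hω =>
      lt_of_le_of_lt hω (Real.exp_lt_exp.2 (by linarith)))

lemma gaussianReal_real_Ici_zero : (gaussianReal 0 1).real (Set.Ici 0) = 1 / 2 := by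
  have hneg : (gaussianReal 0 1).real (Set.Ici 0) = (gaussianReal 0 1).real (Set.Iic 0) := by
    conv_lhs => rw [← neg_zero, ← gaussianReal_map_neg]
    rw [map_measureReal_apply measurable_neg measurableSet_Ici]
    simp
  have hne : NullSingletonClass (gaussianReal 0 1) := nullSingletonClass_gaussianReal one_ne_zero
  have hlt : (gaussianReal 0 1).real (Set.Iio 0) = (gaussianReal 0 1).real (Set.Iic 0) :=
    measureReal_congr Iio_ae_eq_Iic
  have hsum := probReal_add_probReal_compl (μ := gaussianReal 0 1) (s := Set.Ici (0 : ℝ))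
    measurableSet_Ici
  rw [Set.compl_Ici, hlt, ← hneg] at hsum
  linarith

/-- The variables `-(log w + 1)` are centred with variance `1`. The tail at `n + c` is the
probability that their normalized sum of `n + 1` terms, shifted by `(1 - c) / √(n + 1)`, is
nonnegative. The shift vanishes by Slutsky, and the limit is the Gaussian mass of `[0, ∞)`. -/
lemma tendsto_erlangTail (hmeas : ∀ k, Measurable (w k))
    (hunif : ∀ k, pdf.IsUniform (w k) (Set.Ioc (0 : ℝ) 1) P volume) (hindep : iIndepFun w P)
    {c : ℝ} (hc : 0 ≤ c) :
    Tendsto (fun n : ℕ => erlangTail n (n + c)) atTop (𝓝 (1 / 2)) := by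
  have hlogm : Measurable fun x : ℝ => -(Real.log x + 1) := by fun_prop
  have hident : ∀ i, IdentDistrib (fun ω => -(Real.log (w i ω) + 1))
      (fun ω => -(Real.log (w 0 ω) + 1)) P P := fun i =>
    (IdentDistrib.mk (hmeas i).aemeasurable (hmeas 0).aemeasurable (by
      rw [map_eq_restrict_Ioc (hunif i), map_eq_restrict_Ioc (hunif 0)])).comp hlogm
  have hclt := tendstoInDistribution_inv_sqrt_mul_sum (P := P) (P' := gaussianReal 0 1) (Y := id)
    (X := fun k ω => -(Real.log (w k ω) + 1)) HasLaw.id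
    (by
      rw [integral_comp_uniform (hmeas 0) (hunif 0) hlogm, intervalIntegral.integral_neg,
        intervalIntegral.integral_add intervalIntegral.intervalIntegrable_log' (by simp),
        integral_log_zero_one]
      simp)
    (by
      change ∫ ω, (-(Real.log (w 0 ω) + 1)) ^ 2 ∂P = 1
      rw [integral_comp_uniform (hmeas 0) (hunif 0) (hlogm.pow_const 2)]
      simp only [neg_sq]
      exact integral_log_add_one_sq)
    (hindep.comp (fun _ x => -(Real.log x + 1)) fun _ => hlogm) hident
  have hshift : TendstoInMeasure P (fun (n : ℕ) (_ : Ω) => (√(n : ℝ))⁻¹ * (1 - c)) atTop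
      (fun _ => (0 : ℝ)) := by
    refine tendstoInMeasure_of_tendsto_ae (fun _ => aestronglyMeasurable_const) (ae_of_all _ ?_)
    intro _
    have : Tendsto (fun n : ℕ => (√(n : ℝ))⁻¹) atTop (𝓝 0) :=
      tendsto_inv_atTop_zero.comp (Real.tendsto_sqrt_atTop.comp tendsto_natCast_atTop_atTop)
    simpa using this.mul_const (1 - c)
  have hdist := (hclt.add_of_tendstoInMeasure_const hshift fun _ => aemeasurable_const).tendsto
  have hmapid : (gaussianReal 0 1).map (fun x : ℝ => id x + 0) = gaussianReal 0 1 := by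
    simp
  have hport := ProbabilityMeasure.tendsto_measure_of_null_frontier_of_tendsto' hdist
    (E := Set.Ici (0 : ℝ)) (by
      have hne : NullSingletonClass (gaussianReal 0 1) :=
        nullSingletonClass_gaussianReal one_ne_zero
      change (gaussianReal 0 1).map (fun x : ℝ => id x + 0) (frontier (Set.Ici 0)) = 0
      rw [hmapid, frontier_Ici]
      exact measure_singleton _)
  have hfin : (gaussianReal 0 1).map (fun x : ℝ => id x + 0) (Set.Ici (0 : ℝ)) ≠ ⊤ := by
    rw [hmapid]
    exact measure_ne_top _ _
  -- `erlangTail n` concerns `n + 1` factors, hence the index shift.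
  have hreal := ((ENNReal.tendsto_toReal hfin).comp hport).comp
    (tendsto_add_atTop_nat 1)
  have hlim : ((gaussianReal 0 1).map (fun x : ℝ => id x + 0) (Set.Ici (0 : ℝ))).toReal = 1 / 2 := by
    rw [hmapid]
    exact gaussianReal_real_Ici_zero
  refine (hlim ▸ hreal).congr fun n => ?_
  have hT : Measurable ((fun ω => (√((n + 1 : ℕ) : ℝ))⁻¹ *
      ∑ k ∈ Finset.range (n + 1), -(Real.log (w k ω) + 1)) +
      fun _ : Ω => (√((n + 1 : ℕ) : ℝ))⁻¹ * (1 - c)) := by fun_prop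
  rw [← measureReal_prod_le hmeas hunif hindep n _ (by positivity)]
  change ((P.map _) (Set.Ici (0 : ℝ))).toReal = _
  rw [Measure.map_apply hT measurableSet_Ici]
  refine measureReal_congr ?_
  filter_upwards [ae_all_iff.2 fun k => ae_mem_Ioc (hmeas k) (hunif k)] with ω hω
  have hpos : 0 < (√((n + 1 : ℕ) : ℝ))⁻¹ := by positivity
  have hprod : 0 < ∏ k ∈ Finset.range (n + 1), w k ω := Finset.prod_pos fun k _ => (hω k).1
  refine propext ?_
  change 0 ≤ (√((n + 1 : ℕ) : ℝ))⁻¹ * _ + (√((n + 1 : ℕ) : ℝ))⁻¹ * (1 - c) ↔ _ ≤ _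
  rw [← mul_add, mul_nonneg_iff_of_pos_left hpos, ← Real.log_le_iff_le_exp hprod,
    Real.log_prod fun k _ => (hω k).1.ne', Finset.sum_neg_distrib, Finset.sum_add_distrib]
  simp
  constructor <;> intro h <;> linarith

end ErlangLaw

/-! ### Existence, uniqueness and location of the median. -/

section Median

lemma exists_erlangTail_eq_half {n : ℕ} {a b : ℝ} (ha : 1 / 2 ≤ erlangTail n a)
    (hb : erlangTail n b ≤ 1 / 2) (hab : a ≤ b) :
    ∃ x, a ≤ x ∧ x ≤ b ∧ erlangTail n x = 1 / 2 := by
  obtain ⟨x, hx, hx'⟩ := intermediate_value_Icc' hab (continuous_erlangTail n).continuousOn ⟨hb, ha⟩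
  exact ⟨x, hx.1, hx.2, hx'⟩

lemma chainMagnitude_eq {Ω : Type*} (w : ℕ → Ω → ℝ) (τ : ℝ) (L : ℕ) :
    chainMagnitude w τ L = fun ω => τ ^ L * ∏ k ∈ Finset.range L, w k ω := by
  ext ω
  simp [chainMagnitude, Finset.prod_mul_distrib]

variable {Ω : Type*} [MeasurableSpace Ω] {P : Measure Ω} {w : ℕ → Ω → ℝ}

lemma isMedian_const_mul_iff {X : Ω → ℝ} {c : ℝ} (hc : 0 < c) (m : ℝ) :
    IsMedian P (fun ω => c * X ω) m ↔ IsMedian P X (m / c) := by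
  simp only [IsMedian, le_div_iff₀ hc, div_le_iff₀ hc, mul_comm c]

variable [IsProbabilityMeasure P]

lemma isMedian_prod_iff (hmeas : ∀ k, Measurable (w k))
    (hunif : ∀ k, pdf.IsUniform (w k) (Set.Ioc (0 : ℝ) 1) P volume) (hindep : iIndepFun w P)
    {n : ℕ} {x : ℝ} (hx : 0 < x) (hxn : erlangTail n x = 1 / 2) (m : ℝ) :
    IsMedian P (fun ω => ∏ k ∈ Finset.range (n + 1), w k ω) m ↔ m = Real.exp (-x) := by
  have hV := measurable_prod_range hmeas (n + 1)
  have hcompl : ∀ z : ℝ, P.real {ω | z ≤ ∏ k ∈ Finset.range (n + 1), w k ω} =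
      1 - P.real {ω | ∏ k ∈ Finset.range (n + 1), w k ω < z} := by
    intro z
    rw [← probReal_compl_eq_one_sub (measurableSet_lt hV measurable_const)]
    congr 1
    ext ω
    simp
  constructor
  · rintro ⟨h1, h2⟩
    rcases lt_trichotomy m (Real.exp (-x)) with hlt | heq | hgt
    -- Since `m` may be nonpositive, it is replaced by a positive `c` still below `exp (-x)`, so
    -- that `log c` makes sense.
    · obtain ⟨c, hc1, hc2⟩ := exists_between (max_lt hlt (Real.exp_pos (-x)))
      have hc0 : 0 < c := (le_max_right _ _).trans_lt hc1
      have hxc : x < -Real.log c := by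
        have := (Real.log_lt_iff_lt_exp hc0).2 hc2
        linarith
      have h3 := measureReal_prod_le hmeas hunif hindep n (-Real.log c) (hx.trans hxc).le
      rw [neg_neg, Real.exp_log hc0] at h3
      have h4 := strictAntiOn_erlangTail n hx.le (hx.trans hxc).le hxc
      have h5 : P.real {ω | ∏ k ∈ Finset.range (n + 1), w k ω ≤ m} ≤
          P.real {ω | ∏ k ∈ Finset.range (n + 1), w k ω ≤ c} :=
        measureReal_mono (Set.ofPred_subset_ofPred.2 fun ω hω =>
          hω.trans ((le_max_left _ _).trans hc1.le))
      linarith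
    · exact heq
    -- Taking `c < 1` keeps `-log c` in the range where the tail formula holds.
    · obtain ⟨c, hc1, hc2⟩ := exists_between
        (lt_min hgt (show Real.exp (-x) < 1 by simpa using hx))
      have hc0 : 0 < c := (Real.exp_pos _).trans hc1
      have hxc : -Real.log c < x := by
        have := (Real.lt_log_iff_exp_lt hc0).2 hc1
        linarith
      have hxc0 : 0 ≤ -Real.log c :=
        neg_nonneg.2 (Real.log_nonpos hc0.le (hc2.le.trans (min_le_right _ _)))
      have h3 := measureReal_prod_lt hmeas hunif hindep n hxc0
      rw [neg_neg, Real.exp_log hc0] at h3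
      have h4 := strictAntiOn_erlangTail n hxc0 hx.le hxc
      have h5 : P.real {ω | ∏ k ∈ Finset.range (n + 1), w k ω < c} ≤
          P.real {ω | ∏ k ∈ Finset.range (n + 1), w k ω < m} :=
        measureReal_mono (Set.ofPred_subset_ofPred.2 fun ω hω =>
          hω.trans (hc2.trans_le (min_le_left _ _)))
      rw [hcompl] at h2
      linarith
  · rintro rfl
    refine ⟨?_, ?_⟩
    · rw [measureReal_prod_le hmeas hunif hindep n x hx.le, hxn]
    · rw [hcompl, measureReal_prod_lt hmeas hunif hindep n hx.le, hxn]
      norm_num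

lemma exists_median_exponent (hmeas : ∀ k, Measurable (w k))
    (hunif : ∀ k, pdf.IsUniform (w k) (Set.Ioc (0 : ℝ) 1) P volume) (hindep : iIndepFun w P) :
    ∃ Lt : ℕ → ℝ,
      (∀ L : ℕ, 1 ≤ L → (L : ℝ) - 1 / 3 ≤ Lt L ∧ Lt L ≤ (L : ℝ) - 1 + Real.log 2) ∧
      ∀ τ : ℝ, 0 < τ → ∀ L : ℕ, 1 ≤ L → ∀ m : ℝ,
        IsMedian P (chainMagnitude w τ L) m ↔ m = Real.exp ((L : ℝ) * Real.log τ - Lt L) := by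
  have hlog := Real.log_two_gt_d9
  have hex : ∀ n : ℕ, ∃ x : ℝ, n + 2 / 3 ≤ x ∧ x ≤ n + Real.log 2 ∧ erlangTail n x = 1 / 2 :=
    fun n => exists_erlangTail_eq_half
      (half_le_erlangTail (tendsto_erlangTail hmeas hunif hindep (by norm_num)) n)
      (erlangTail_le_half (tendsto_erlangTail hmeas hunif hindep (by linarith)) n)
      (by linarith)
  choose x hx1 hx2 hx3 using hex
  refine ⟨fun L => x (L - 1), fun L hL => ?_, fun τ hτ L hL m => ?_⟩
  · obtain ⟨n, rfl⟩ := Nat.exists_eq_add_of_le' hL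
    have := hx1 n
    have := hx2 n
    simp only [Nat.add_sub_cancel]
    push_cast
    constructor <;> linarith
  · obtain ⟨n, rfl⟩ := Nat.exists_eq_add_of_le' hL
    have hx0 : 0 < x n := lt_of_lt_of_le (by positivity) (hx1 n)
    rw [chainMagnitude_eq, isMedian_const_mul_iff (by positivity),
      isMedian_prod_iff hmeas hunif hindep hx0 (hx3 n), div_eq_iff (by positivity),
      sub_eq_add_neg, Real.exp_add, mul_comm ((n + 1 : ℕ) : ℝ), Real.exp_mul, Real.exp_log hτ,
      Real.rpow_natCast, mul_comm]
    simp

lemma tendsto_exp_mul_log_sub {Lt m : ℕ → ℝ} {τ : ℝ} (hτ : Real.log τ < 1)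
    (hLt : ∀ L : ℕ, 1 ≤ L → (L : ℝ) - 1 / 3 ≤ Lt L)
    (hm : ∀ L : ℕ, 1 ≤ L → m L = Real.exp ((L : ℝ) * Real.log τ - Lt L)) :
    Tendsto m atTop (𝓝 0) := by
  have hlin : Tendsto (fun L : ℕ => (L : ℝ) * (Real.log τ - 1) + 1 / 3) atTop atBot :=
    tendsto_atBot_add_const_right _ _
      (tendsto_natCast_atTop_atTop.atTop_mul_const_of_neg (by linarith))
  refine tendsto_of_tendsto_of_tendsto_of_le_of_le' tendsto_const_nhds
    (Real.tendsto_exp_atBot.comp hlin) ?_ ?_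
  · filter_upwards [eventually_ge_atTop 1] with L hL
    rw [hm L hL]
    positivity
  · filter_upwards [eventually_ge_atTop 1] with L hL
    rw [hm L hL]
    refine Real.exp_le_exp.2 ?_
    have := hLt L hL
    linarith

end Median

/-! ### Moments of the product. -/

section Moments

variable {Ω : Type*} [MeasurableSpace Ω] {P : Measure Ω} [IsProbabilityMeasure P] {w : ℕ → Ω → ℝ}

lemma integral_prod_range_pow (hmeas : ∀ k, Measurable (w k))
    (hunif : ∀ k, pdf.IsUniform (w k) (Set.Ioc (0 : ℝ) 1) P volume) (hindep : iIndepFun w P)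
    (p L : ℕ) :
    ∫ ω, (∏ k ∈ Finset.range L, w k ω) ^ p ∂P = (((p : ℝ) + 1)⁻¹) ^ L := by
  induction L with
  | zero => simp
  | succ L ih =>
    have hpow : Measurable fun x : ℝ => x ^ p := measurable_id.pow_const p
    have hind := (indepFun_prod_range hmeas hindep L).comp hpow hpow
    simp_rw [Finset.prod_range_succ, mul_pow]
    have h := hind.integral_fun_mul_eq_mul_integral
      (((measurable_prod_range hmeas L).pow_const p).aestronglyMeasurable)
      (((hmeas L).pow_const p).aestronglyMeasurable)
    simp only [Function.comp_def] at h
    rw [h, ih, integral_comp_uniform (hmeas L) (hunif L) hpow, pow_succ]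
    simp

lemma integrable_prod_range_pow (hmeas : ∀ k, Measurable (w k))
    (hunif : ∀ k, pdf.IsUniform (w k) (Set.Ioc (0 : ℝ) 1) P volume) (p L : ℕ) :
    Integrable (fun ω => (∏ k ∈ Finset.range L, w k ω) ^ p) P := by
  refine Integrable.of_bound ((measurable_prod_range hmeas L).pow_const p).aestronglyMeasurable 1 ?_
  filter_upwards [ae_all_iff.2 fun k => ae_mem_Ioc (hmeas k) (hunif k)] with ω hω
  rw [norm_pow, Real.norm_eq_abs, abs_of_nonneg (Finset.prod_nonneg fun k _ => (hω k).1.le)]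
  exact pow_le_one₀ (Finset.prod_nonneg fun k _ => (hω k).1.le)
    (Finset.prod_le_one (fun k _ => (hω k).1.le) fun k _ => (hω k).2)

lemma integral_chainMagnitude_pow (hmeas : ∀ k, Measurable (w k))
    (hunif : ∀ k, pdf.IsUniform (w k) (Set.Ioc (0 : ℝ) 1) P volume) (hindep : iIndepFun w P)
    (τ : ℝ) (p L : ℕ) :
    Integrable (fun ω => chainMagnitude w τ L ω ^ p) P ∧
      ∫ ω, chainMagnitude w τ L ω ^ p ∂P = (τ ^ p / ((p : ℝ) + 1)) ^ L := by
  simp only [chainMagnitude_eq, mul_pow]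
  refine ⟨(integrable_prod_range_pow hmeas hunif p L).const_mul _, ?_⟩
  rw [integral_const_mul, integral_prod_range_pow hmeas hunif hindep, div_pow, inv_pow,
    ← pow_mul, ← pow_mul, mul_comm p, div_eq_mul_inv]

end Moments

/-! ### Almost sure exponential rate. -/

section AlmostSure

variable {Ω : Type*} [MeasurableSpace Ω] {P : Measure Ω} {w : ℕ → Ω → ℝ}

lemma ae_tendsto_sum_log_div (hmeas : ∀ k, Measurable (w k))
    (hunif : ∀ k, pdf.IsUniform (w k) (Set.Ioc (0 : ℝ) 1) P volume) (hindep : iIndepFun w P) :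
    ∀ᵐ ω ∂P, Tendsto (fun L : ℕ => (∑ k ∈ Finset.range L, Real.log (w k ω)) / L) atTop
      (𝓝 (-1)) := by
  have h := strong_law_ae_real (fun k ω => Real.log (w k ω))
    (integrable_comp_uniform (hmeas 0) (hunif 0) Real.measurable_log
      intervalIntegral.intervalIntegrable_log')
    (fun i j hij => (hindep.indepFun hij).comp Real.measurable_log Real.measurable_log)
    (fun i => (IdentDistrib.mk (hmeas i).aemeasurable (hmeas 0).aemeasurable (by
      rw [map_eq_restrict_Ioc (hunif i), map_eq_restrict_Ioc (hunif 0)])).comp Real.measurable_log)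
  rwa [integral_comp_uniform (hmeas 0) (hunif 0) Real.measurable_log, integral_log_zero_one] at h

lemma ae_tendsto_chainMagnitude_rpow (hmeas : ∀ k, Measurable (w k))
    (hunif : ∀ k, pdf.IsUniform (w k) (Set.Ioc (0 : ℝ) 1) P volume) (hindep : iIndepFun w P)
    {τ : ℝ} (hτ : 0 < τ) : ∀ᵐ ω ∂P,
      Tendsto (fun L : ℕ => chainMagnitude w τ L ω ^ ((1 : ℝ) / (L : ℝ))) atTop
        (𝓝 (τ / Real.exp 1)) ∧
      ∃ r : ℕ → ℝ, r =o[atTop] (fun L : ℕ => (L : ℝ)) ∧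
        ∀ L : ℕ, chainMagnitude w τ L ω
          = Real.exp (-((L : ℝ) * (1 - Real.log τ)) + r L) := by
  filter_upwards [ae_tendsto_sum_log_div hmeas hunif hindep,
    ae_all_iff.2 fun k => ae_mem_Ioc (hmeas k) (hunif k)] with ω hlim hω
  have hv : ∀ L : ℕ, chainMagnitude w τ L ω =
      Real.exp (L * Real.log τ + ∑ k ∈ Finset.range L, Real.log (w k ω)) := by
    intro L
    rw [Real.exp_add, ← Real.log_prod fun k _ => (hω k).1.ne',
      Real.exp_log (Finset.prod_pos fun k _ => (hω k).1), mul_comm (L : ℝ), Real.exp_mul,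
      Real.exp_log hτ, Real.rpow_natCast, chainMagnitude_eq]
  -- The remainder is `∑ log w_k + L`, the deviation of the log-sum from its mean `-L`; the strong
  -- law makes it `o(L)`.
  refine ⟨?_, fun L => ∑ k ∈ Finset.range L, Real.log (w k ω) + L, ?_, fun L => ?_⟩
  · have h : Tendsto (fun L : ℕ => Real.exp (Real.log τ +
        (∑ k ∈ Finset.range L, Real.log (w k ω)) / L)) atTop (𝓝 (Real.exp (Real.log τ + -1))) :=
      (Real.continuous_exp.tendsto _).comp (hlim.const_add _)
    rw [Real.exp_add, Real.exp_log hτ, Real.exp_neg, ← div_eq_mul_inv] at h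
    refine h.congr' ?_
    filter_upwards [eventually_ge_atTop 1] with L hL
    have hL0 : (L : ℝ) ≠ 0 := by positivity
    rw [hv, ← Real.exp_mul]
    congr 1
    field_simp
  · rw [isLittleO_iff_tendsto' (by
      filter_upwards [eventually_ge_atTop 1] with L hL h0
      exact absurd h0 (by positivity))]
    have h := hlim.add_const 1
    rw [neg_add_cancel] at h
    refine h.congr' ?_
    filter_upwards [eventually_ge_atTop 1] with L hL
    have hL0 : (L : ℝ) ≠ 0 := by positivity
    field_simp
  · rw [hv]
    congr 1
    ring

end AlmostSure

/-! ### Assembly of the five parts. -/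

theorem proposition3 {Ω : Type*} [MeasurableSpace Ω] (P : Measure Ω) [IsProbabilityMeasure P]
    (w : ℕ → Ω → ℝ) (hmeas : ∀ k, Measurable (w k))
    (hunif : ∀ k, pdf.IsUniform (w k) (Set.Ioc (0 : ℝ) 1) P volume)
    (hindep : iIndepFun w P) :
    -- the median is unique, equals `exp (L log τ - L̃)`, and `L̃` depends on `L` only
    (∃ Lt : ℕ → ℝ,
      (∀ L : ℕ, 1 ≤ L →
        (L : ℝ) - 1 / 3 ≤ Lt L ∧ Lt L ≤ (L : ℝ) - 1 + Real.log 2) ∧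
      ∀ τ : ℝ, 0 < τ → ∀ L : ℕ, 1 ≤ L → ∀ m : ℝ,
        IsMedian P (chainMagnitude w τ L) m ↔ m = Real.exp ((L : ℝ) * Real.log τ - Lt L)) ∧
    -- `τ = 2`: vanishing median, mean one, exploding second moment
    ((∀ m : ℕ → ℝ, (∀ L : ℕ, 1 ≤ L → IsMedian P (chainMagnitude w 2 L) (m L)) →
        Tendsto m atTop (𝓝 0)) ∧
      (∀ L : ℕ, Integrable (chainMagnitude w 2 L) P ∧ ∫ ω, chainMagnitude w 2 L ω ∂P = 1) ∧
      (∀ L : ℕ, Integrable (fun ω => chainMagnitude w 2 L ω ^ 2) P) ∧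
      Tendsto (fun L : ℕ => ∫ ω, chainMagnitude w 2 L ω ^ 2 ∂P) atTop atTop) ∧
    -- `τ = √3`: vanishing median, second moment one
    ((∀ m : ℕ → ℝ, (∀ L : ℕ, 1 ≤ L → IsMedian P (chainMagnitude w (Real.sqrt 3) L) (m L)) →
        Tendsto m atTop (𝓝 0)) ∧
      (∀ L : ℕ, Integrable (fun ω => chainMagnitude w (Real.sqrt 3) L ω ^ 2) P ∧
        ∫ ω, chainMagnitude w (Real.sqrt 3) L ω ^ 2 ∂P = 1)) ∧
    -- `τ = e`: the median stays in a fixed compact subinterval of `(0, ∞)`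
    (∀ L : ℕ, 1 ≤ L → ∀ m : ℝ, IsMedian P (chainMagnitude w (Real.exp 1) L) m →
      Real.exp 1 / 2 ≤ m ∧ m ≤ Real.exp (1 / 3)) ∧
    -- almost sure behaviour: limit of the `L`-th root, and the resulting exponential rate
    (∀ τ : ℝ, 0 < τ → ∀ᵐ ω ∂P,
      Tendsto (fun L : ℕ => chainMagnitude w τ L ω ^ ((1 : ℝ) / (L : ℝ))) atTop
        (𝓝 (τ / Real.exp 1)) ∧
      ∃ r : ℕ → ℝ, r =o[atTop] (fun L : ℕ => (L : ℝ)) ∧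
        ∀ L : ℕ, chainMagnitude w τ L ω
          = Real.exp (-((L : ℝ) * (1 - Real.log τ)) + r L)) := by
  obtain ⟨Lt, hLt, hmed⟩ := exists_median_exponent hmeas hunif hindep
  refine ⟨⟨Lt, hLt, hmed⟩, ⟨fun m hm => ?_, fun L => ?_, fun L => ?_, ?_⟩,
    ⟨fun m hm => ?_, fun L => ?_⟩, fun L hL m hm => ?_, fun τ hτ => ae_tendsto_chainMagnitude_rpow hmeas hunif hindep hτ⟩
  · exact tendsto_exp_mul_log_sub (by linarith [Real.log_two_lt_d9]) (fun L hL => (hLt L hL).1)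
      fun L hL => (hmed 2 two_pos L hL _).1 (hm L hL)
  · have h := integral_chainMagnitude_pow hmeas hunif hindep 2 1 L
    norm_num at h
    exact h
  · exact (integral_chainMagnitude_pow hmeas hunif hindep 2 2 L).1
  -- The second moment is `(4/3) ^ L`.
  · simp_rw [(integral_chainMagnitude_pow hmeas hunif hindep 2 2 _).2]
    exact tendsto_pow_atTop_atTop_of_one_lt (by norm_num)
  · have h3 : Real.log (√3) < 1 := by
      rw [Real.log_lt_iff_lt_exp (by positivity)]
      have h2 : √3 < 2 := by
        rw [Real.sqrt_lt' two_pos]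
        norm_num
      linarith [Real.exp_one_gt_d9]
    exact tendsto_exp_mul_log_sub h3 (fun L hL => (hLt L hL).1)
      fun L hL => (hmed (√3) (by positivity) L hL _).1 (hm L hL)
  · have h := integral_chainMagnitude_pow hmeas hunif hindep (√3) 2 L
    rw [Real.sq_sqrt (by norm_num)] at h
    norm_num at h
    exact h
  -- For `τ = e` the exponent is `L - L̃`, which lies between `1 - log 2` and `1/3`.
  · rw [(hmed _ (Real.exp_pos 1) L hL m).1 hm, Real.log_exp, mul_one]
    obtain ⟨h1, h2⟩ := hLt L hL
    refine ⟨?_, Real.exp_le_exp.2 (by linarith)⟩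
    rw [show Real.exp 1 / 2 = Real.exp (1 - Real.log 2) by
      rw [Real.exp_sub, Real.exp_log two_pos]]
    exact Real.exp_le_exp.2 (by linarith)
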